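/- For $n\ge 1$ let $\mathcal T_n$ be the (finite) set of rooted trees labeled with $\{1,\dots,n\}$, that is, of pairs $(T,r)$ where $T$ is a tree with node set $\{1,\dots,n\}$ and $r$ is one of its nodes, the root; endow $\mathcal T_n$ with the uniform probability distribution $\mathbf P_n$. In a rooted tree $(T,r)$ a child of a node $v$ is a neighbor of $v$ that is farther from $r$ than $v$ is, and a leaf is a node with no children (so a node other than the root is a leaf exactly when its degree is $1$, and the root is a leaf only if $n=1$). Let $\mathcal T_n^{(3)}\subseteq\mathcal T_n$ be the set of those $(T,r)$ in which the root $r$ is at graph distance at least $3$ from every leaf. Then $$\lim_{n\to\infty}\mathbf P_n\big(\mathcal T_n^{(3)}\big)=c_3:=\frac1e\,e^{-1/e}\,e^{(e^{1-1/e}-1)/e},$$ and $c_3\approx 0.3522$, in the sense that $|c_3-0.3522|<0.00005$. -/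

import Mathlib

/-- The rooted labeled trees on `n` nodes: pairs `(T, r)` of a tree `T` on the labels `Fin n` and a
distinguished node `r`, the root. -/
def rootedTrees (n : ℕ) : Set (SimpleGraph (Fin n) × Fin n) :=
  {p | p.1.IsTree}

/-- In the tree `G` rooted at `r`, the node `w` is a child (immediate descendant) of `v`:
it is adjacent to `v` and one step farther away from the root. -/
def IsChild {V : Type*} (G : SimpleGraph V) (r v w : V) : Prop :=
  G.Adj v w ∧ G.dist r w = G.dist r v + 1

/-- The boundary of the tree `G` rooted at `r`: its leaves, i.e. the nodes without descendants.
For a node other than the root this says that its degree is 1; the root itself is a leaf only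
in the tree with a single node. -/
def leaves {V : Type*} (G : SimpleGraph V) (r : V) : Set V :=
  {v | ∀ w, ¬ IsChild G r v w}

/-- The distance from the root `r` to the boundary of the tree `G` rooted at `r`. -/
noncomputable def rootDist {V : Type*} (G : SimpleGraph V) (r : V) : ℕ∞ :=
  ⨅ v ∈ leaves G r, G.edist r v

/-- The rooted labeled trees on `n` nodes whose root is at distance at least 3 from the boundary. -/
def deepRootedTrees (n : ℕ) : Set (SimpleGraph (Fin n) × Fin n) :=
  {p | p ∈ rootedTrees n ∧ 3 ≤ rootDist p.1 p.2}

/-- The probability, for the uniform distribution on the rooted labeled trees on `n` nodes,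
that the root is at distance at least 3 from the boundary. -/
noncomputable def deepRootProb (n : ℕ) : ℝ :=
  ((deepRootedTrees n).ncard : ℝ) / ((rootedTrees n).ncard : ℝ)

/-- The constant `c₃ = e⁻¹ · e^{-1/e} · e^{(e^{1-1/e}-1)/e}`. -/
noncomputable def c₃ : ℝ :=
  1 / Real.exp 1 * Real.exp (-(1 / Real.exp 1)) *
    Real.exp ((Real.exp (1 - 1 / Real.exp 1) - 1) / Real.exp 1)

/-! A tree rooted at `r` is the same as its parent function, and the root is at distance at least
`d` from every leaf exactly when every node at depth less than `d` has a child. Parent functions are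
counted by peeling off layers. If the current layer has `k` nodes and the next has `j`, the next
layer maps onto the current one by a surjection, and the rest is a forest over `j` roots. This gives
the recursion `deepCount`, started from Cayley's forest formula `k (N + k) ^ (N - 1)`.

After division by `N ^ (N - 1)`, the counts tend to `k β α ^ (k - 1)` for every `k`
(`tendsto_deepCount`). Dominated convergence passes to the limit in the recursion. The resulting
series is the derivative of `∑ surj(j, k) x ^ j / j! = (e ^ x - 1) ^ k` at `x = α / e`
(`hasSum_surjCount`), so the shape persists with new `(α, β)`. Three iterations from `(e, e)` give
`β = e c₃`. For `d = 0`, `k = 1` the limit, belonging to all trees, is `e`, so the quotient is `c₃`.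
-/

/-- `f` is the parent function of a forest with root set `R` and set of non-roots `N`:
the nodes of `N` are exhausted by repeatedly removing those whose parent is a root and making
these the new roots. -/
inductive IsForestMap {α : Type*} [DecidableEq α] (f : α → α) : Finset α → Finset α → Prop
  | nil (R : Finset α) : IsForestMap f R ∅
  | step (R N : Finset α) :
      IsForestMap f (N.filter (f · ∈ R)) (N \ N.filter (f · ∈ R)) → IsForestMap f R N

/-- In the forest with parent function `f`, roots `R` and non-roots `N`, every node at distance
less than `d` from the roots has a child. -/
def IsDeepMap {α : Type*} [DecidableEq α] (f : α → α) : ℕ → Finset α → Finset α → Prop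
  | 0, _, _ => True
  | d + 1, R, N => (∀ r ∈ R, ∃ v ∈ N, f v = r) ∧
      IsDeepMap f d (N.filter (f · ∈ R)) (N \ N.filter (f · ∈ R))

/-- The number of surjections from a set of size `j` onto a set of size `k`. -/
noncomputable def surjCount (j k : ℕ) : ℕ :=
  Nat.card {g : Fin j → Fin k // Function.Surjective g}

/-- The number of forests with `k` given roots and `N` further labeled nodes. -/
def forestCount (N k : ℕ) : ℕ :=
  if N = 0 then 1 else k * (N + k) ^ (N - 1)

/-- The number of forests with `k` given roots and `N` further labeled nodes in which every node at
distance less than `d` from the roots has a child. -/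
noncomputable def deepCount : ℕ → ℕ → ℕ → ℕ
  | 0, N, k => forestCount N k
  | d + 1, N, k => ∑ j ∈ Finset.range (N + 1), N.choose j * (surjCount j k * deepCount d (N - j) j)

/-! ### Parent functions, ranks and layers -/

section ForestMap

variable {α : Type*} [DecidableEq α] {f g : α → α} {R N : Finset α}

lemma isForestMap_step_iff :
    IsForestMap f R N ↔ IsForestMap f (N.filter (f · ∈ R)) (N \ N.filter (f · ∈ R)) := by
  refine ⟨fun h => ?_, IsForestMap.step R N⟩
  cases h with
  | nil => simpa using IsForestMap.nil _
  | step _ _ h => exact h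

lemma IsForestMap.mem_or_mem (h : IsForestMap f R N) : ∀ v ∈ N, f v ∈ R ∨ f v ∈ N := by
  induction h with
  | nil R => simp
  | step R N _ ih =>
    intro v hv
    by_cases hR : f v ∈ R
    · exact Or.inl hR
    · rcases ih v (by simp [hv, hR]) with h | h
      · exact Or.inr (Finset.mem_filter.1 h).1
      · exact Or.inr (Finset.mem_sdiff.1 h).1

lemma IsForestMap.congr (h : IsForestMap f R N) (hfg : ∀ v ∈ N, f v = g v) :
    IsForestMap g R N := by
  induction h with
  | nil R => exact IsForestMap.nil R
  | step R N _ ih =>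
    have : N.filter (f · ∈ R) = N.filter (g · ∈ R) :=
      Finset.filter_congr fun v hv => by rw [hfg v hv]
    rw [this] at ih
    exact IsForestMap.step R N (ih fun v hv => hfg v (Finset.mem_sdiff.1 hv).1)

lemma isForestMap_congr (hfg : ∀ v ∈ N, f v = g v) : IsForestMap f R N ↔ IsForestMap g R N :=
  ⟨fun h => h.congr hfg, fun h => h.congr fun v hv => (hfg v hv).symm⟩

lemma isDeepMap_congr {d : ℕ} (hfg : ∀ v ∈ N, f v = g v) :
    IsDeepMap f d R N ↔ IsDeepMap g d R N := by
  induction d generalizing R N with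
  | zero => rfl
  | succ d ih =>
    have : N.filter (f · ∈ R) = N.filter (g · ∈ R) :=
      Finset.filter_congr fun v hv => by rw [hfg v hv]
    rw [IsDeepMap, IsDeepMap, this]
    refine and_congr ?_ (ih fun v hv => hfg v (Finset.mem_sdiff.1 hv).1)
    refine forall₂_congr fun r _ => exists_congr fun v => and_congr_right fun hv => ?_
    rw [hfg v hv]

lemma IsForestMap.eq_empty_of_roots (h : IsForestMap f ∅ N) : N = ∅ := by
  suffices ∀ R, IsForestMap f R N → R = ∅ → N = ∅ from this ∅ h rfl
  clear h
  intro R h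
  induction h with
  | nil R => exact fun _ => rfl
  | step R N _ ih =>
    rintro rfl
    simpa using ih (by simp)

/-- A node of least rank in `N` has its parent in `R`, so every peeling step removes something and
the process ends. -/
lemma isForestMap_of_rank (μ : α → ℕ) (hN : ∀ v ∈ N, f v ∈ R ∨ f v ∈ N)
    (hμ : ∀ v ∈ N, μ (f v) < μ v) : IsForestMap f R N := by
  induction hn : N.card using Nat.strong_induction_on generalizing R N with
  | _ n ih =>
    rcases N.eq_empty_or_nonempty with rfl | hne
    · exact IsForestMap.nil R
    · refine IsForestMap.step R N (ih _ ?_ ?_ ?_ rfl)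
      · obtain ⟨v, hv, hmin⟩ := N.exists_min_image μ hne
        have hvR : f v ∈ R := (hN v hv).resolve_right fun h => (hmin _ h).not_gt (hμ v hv)
        rw [← hn]
        refine Finset.card_lt_card ((Finset.ssubset_iff_of_subset Finset.sdiff_subset).2
          ⟨v, hv, by simp [hv, hvR]⟩)
      · intro v hv
        have hv' := Finset.mem_sdiff.1 hv
        have hR : f v ∉ R := fun h => hv'.2 (by simp [hv'.1, h])
        have := (hN v hv'.1).resolve_left hR
        by_cases h : f (f v) ∈ R
        · left; simp [this, h]
        · right; simp [this, h]
      · exact fun v hv => hμ v (Finset.mem_sdiff.1 hv).1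

lemma IsForestMap.exists_rank (h : IsForestMap f R N) (hRN : Disjoint R N) :
    ∃ μ : α → ℕ, (∀ v ∈ R, μ v = 0) ∧ ∀ v ∈ N, μ v = μ (f v) + 1 := by
  induction h with
  | nil R => exact ⟨fun _ => 0, by simp, by simp⟩
  | step R N h ih =>
    obtain ⟨μ, h0, h1⟩ := ih Finset.disjoint_sdiff
    refine ⟨fun v => if v ∈ R then 0 else μ v + 1, fun v hv => by simp [hv], fun v hv => ?_⟩
    have hvR : v ∉ R := fun h => Finset.disjoint_left.1 hRN h hv
    by_cases hR : f v ∈ R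
    · simp [hvR, hR, h0 v (by simp [hv, hR])]
    · simp [hvR, hR, h1 v (by simp [hv, hR])]

/-- Turns the layerwise definition into one condition on depths. The offset `c` is the depth of the
current roots; it grows by one at each peeling. -/
lemma isDeepMap_iff_of_rank {μ : α → ℕ} {d c : ℕ} (hRN : Disjoint R N)
    (hN : ∀ v ∈ N, f v ∈ R ∨ f v ∈ N) (h0 : ∀ v ∈ R, μ v = c) (hc : ∀ v ∈ N, c < μ v)
    (h1 : ∀ v ∈ N, μ v = μ (f v) + 1) :
    IsDeepMap f d R N ↔ ∀ v ∈ R ∪ N, μ v < c + d → ∃ w ∈ N, f w = v := by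
  induction d generalizing R N c with
  | zero =>
    simp only [IsDeepMap, true_iff, Finset.mem_union]
    rintro v (hv | hv) h
    · have := h0 v hv; omega
    · have := hc v hv; omega
  | succ d ih =>
    have hmem : ∀ v ∈ N, (f v ∈ R ↔ μ v = c + 1) := by
      intro v hv
      constructor
      · intro h; rw [h1 v hv, h0 _ h]
      · intro h
        refine (hN v hv).resolve_right fun h' => ?_
        have := hc _ h'; have := h1 v hv; omega
    rw [IsDeepMap, ih (c := c + 1) Finset.disjoint_sdiff ?_ ?_ ?_ ?_]
    · have hU : N.filter (f · ∈ R) ∪ N \ N.filter (f · ∈ R) = N :=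
        Finset.union_sdiff_of_subset (Finset.filter_subset _ _)
      rw [hU]
      constructor
      · rintro ⟨hr, hd⟩ v hv hlt
        rcases Finset.mem_union.1 hv with hv | hv
        · exact hr v hv
        · obtain ⟨w, hw, hwv⟩ := hd v hv (by omega)
          exact ⟨w, (Finset.mem_sdiff.1 hw).1, hwv⟩
      · intro h
        refine ⟨fun r hr => h r (Finset.mem_union_left _ hr) (by have := h0 r hr; omega),
          fun v hv hlt => ?_⟩
        obtain ⟨w, hw, hwv⟩ := h v (Finset.mem_union_right _ hv) (by omega)
        refine ⟨w, Finset.mem_sdiff.2 ⟨hw, fun hw' => ?_⟩, hwv⟩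
        have := (Finset.mem_filter.1 hw').2
        rw [hwv] at this
        exact Finset.disjoint_left.1 hRN this hv
    · intro v hv
      have hv' := Finset.mem_sdiff.1 hv
      have hR : f v ∉ R := fun h => hv'.2 (by simp [hv'.1, h])
      have := (hN v hv'.1).resolve_left hR
      by_cases h : f (f v) ∈ R
      · left; simp [this, h]
      · right; simp [this, h]
    · intro v hv
      have hv' := Finset.mem_filter.1 hv
      exact (hmem v hv'.1).1 hv'.2
    · intro v hv
      have hv' := Finset.mem_sdiff.1 hv
      have h2 : μ v ≠ c + 1 := fun h => hv'.2 (by simp [hv'.1, (hmem v hv'.1).2 h])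
      have := hc v hv'.1
      omega
    · exact fun v hv => h1 v (Finset.mem_sdiff.1 hv).1

end ForestMap

/-! ### Counting parent functions layer by layer -/

section Count

variable {α : Type*} [DecidableEq α] [Fintype α]

open Classical in
/-- The parent functions of forests with roots `R` and non-roots `N`, extended by the identity, in
which every node at distance less than `d` from the roots has a child. -/
noncomputable def deepMaps (d : ℕ) (R N : Finset α) : Finset (α → α) :=
  {f | (∀ v ∉ N, f v = v) ∧ IsForestMap f R N ∧ IsDeepMap f d R N}

lemma mem_deepMaps {d : ℕ} {R N : Finset α} {f : α → α} :
    f ∈ deepMaps d R N ↔ (∀ v ∉ N, f v = v) ∧ IsForestMap f R N ∧ IsDeepMap f d R N := by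
  classical
  simp [deepMaps]

-- Cutting `f` at its first layer `S` gives independent data: a map `S → R` and a forest on `N \ S`
-- over `S`. Keeping `P` arbitrary lets one bijection serve both recursions, with all maps and with
-- surjections.
open Classical in
lemma card_maps_with_layer {d : ℕ} {R N S : Finset α} (hRN : Disjoint R N) (hS : S ⊆ N)
    (P : (S → R) → Prop) :
    (Finset.univ.filter fun f : α → α => (∀ v ∉ N, f v = v) ∧ N.filter (f · ∈ R) = S ∧
      (∃ g : S → R, P g ∧ ∀ s : S, f s = g s) ∧
      IsForestMap f S (N \ S) ∧ IsDeepMap f d S (N \ S)).card =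
    (Finset.univ.filter P).card * (deepMaps d S (N \ S)).card := by
  rw [← Finset.card_product]
  symm
  have key : ∀ (g : S → R) (h : α → α), ∀ v ∈ N \ S,
      (if hv : v ∈ S then (g ⟨v, hv⟩ : α) else h v) = h v := by
    intro g h v hv
    rw [dif_neg (Finset.mem_sdiff.1 hv).2]
  refine Finset.card_bij
    (fun gh _ v => if hv : v ∈ S then (gh.1 ⟨v, hv⟩ : α) else gh.2 v) ?_ ?_ ?_
  · rintro ⟨g, h⟩ hgh
    obtain ⟨hg, hh⟩ := Finset.mem_product.1 hgh
    obtain ⟨hid, hF, hD⟩ := mem_deepMaps.1 hh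
    simp only [Finset.mem_filter, Finset.mem_univ, true_and] at hg ⊢
    refine ⟨fun v hv => ?_, ?_, ⟨g, hg, fun s => by simp⟩,
      (isForestMap_congr (key g h)).2 hF, (isDeepMap_congr (key g h)).2 hD⟩
    · rw [dif_neg fun h => hv (hS h)]
      exact hid v fun h => hv (Finset.mem_sdiff.1 h).1
    · ext v
      simp only [Finset.mem_filter]
      constructor
      · rintro ⟨hv, hR⟩
        by_contra hvS
        rw [dif_neg hvS] at hR
        -- Outside `S` the parent stays in `N`, hence never lies in `R`: the first layer is exactly
        -- `S`.
        have := hF.mem_or_mem v (Finset.mem_sdiff.2 ⟨hv, hvS⟩)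
        refine Finset.disjoint_left.1 hRN hR ?_
        rcases this with h | h
        · exact hS h
        · exact (Finset.mem_sdiff.1 h).1
      · intro hv
        exact ⟨hS hv, by simp [hv]⟩
  · rintro ⟨g, h⟩ hgh ⟨g', h'⟩ hgh' heq
    have hid := (mem_deepMaps.1 (Finset.mem_product.1 hgh).2).1
    have hid' := (mem_deepMaps.1 (Finset.mem_product.1 hgh').2).1
    refine Prod.ext (funext fun s => Subtype.ext ?_) (funext fun v => ?_)
    · exact (dif_pos s.2).symm.trans ((congrFun heq s).trans (dif_pos s.2))
    · by_cases hv : v ∈ S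
      · have hv' : v ∉ N \ S := fun h => (Finset.mem_sdiff.1 h).2 hv
        exact (hid v hv').trans (hid' v hv').symm
      · exact (dif_neg hv).symm.trans ((congrFun heq v).trans (dif_neg hv))
  · intro f hf
    simp only [Finset.mem_filter, Finset.mem_univ, true_and] at hf
    obtain ⟨hid, hlay, ⟨g, hg, hfg⟩, hF, hD⟩ := hf
    have hcong : ∀ v ∈ N \ S, f v = (if v ∈ S then v else f v) := fun v hv => by
      rw [if_neg (Finset.mem_sdiff.1 hv).2]
    refine ⟨(g, fun v => if v ∈ S then v else f v), ?_, ?_⟩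
    · refine Finset.mem_product.2 ⟨by simpa using hg, mem_deepMaps.2 ⟨fun v hv => ?_,
        (isForestMap_congr hcong).1 hF, (isDeepMap_congr hcong).1 hD⟩⟩
      by_cases hvS : v ∈ S
      · simp [hvS]
      · simpa [hvS] using hid v fun h => hv (Finset.mem_sdiff.2 ⟨h, hvS⟩)
    · funext v
      by_cases hv : v ∈ S
      · exact (dif_pos hv).trans (hfg ⟨v, hv⟩).symm
      · exact (dif_neg hv).trans (if_neg hv)

open Classical in
lemma card_deepMaps_zero_eq_sum {R N : Finset α} (hRN : Disjoint R N) :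
    (deepMaps 0 R N).card =
      ∑ S ∈ N.powerset, R.card ^ S.card * (deepMaps 0 S (N \ S)).card := by
  rw [Finset.card_eq_sum_card_fiberwise (f := fun f => N.filter (f · ∈ R)) (t := N.powerset)
    (fun f _ => Finset.mem_coe.2 (Finset.mem_powerset.2 (Finset.filter_subset _ _)))]
  refine Finset.sum_congr rfl fun S hS => ?_
  have := card_maps_with_layer (d := 0) hRN (Finset.mem_powerset.1 hS) fun _ => True
  rw [Finset.filter_true, Finset.card_univ, Fintype.card_fun, Fintype.card_coe,
    Fintype.card_coe] at this
  rw [← this]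
  congr 1
  ext f
  simp only [Finset.mem_filter, mem_deepMaps, Finset.mem_univ, true_and, IsDeepMap, and_true]
  constructor
  · rintro ⟨⟨hid, hF⟩, rfl⟩
    exact ⟨hid, rfl, ⟨fun s => ⟨f s, (Finset.mem_filter.1 s.2).2⟩, fun s => rfl⟩,
      isForestMap_step_iff.1 hF⟩
  · rintro ⟨hid, rfl, _, hF⟩
    exact ⟨⟨hid, isForestMap_step_iff.2 hF⟩, rfl⟩

lemma card_surjective (β γ : Type*) [Fintype β] [Fintype γ] :
    Nat.card {g : β → γ // Function.Surjective g} =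
      surjCount (Fintype.card β) (Fintype.card γ) := by
  refine Nat.card_congr (Equiv.subtypeEquiv
    (Equiv.arrowCongr (Fintype.equivFin β) (Fintype.equivFin γ)) fun g => ?_)
  simp [Equiv.arrowCongr]

open Classical in
lemma card_deepMaps_succ_eq_sum {d : ℕ} {R N : Finset α} (hRN : Disjoint R N) :
    (deepMaps (d + 1) R N).card =
      ∑ S ∈ N.powerset, surjCount S.card R.card * (deepMaps d S (N \ S)).card := by
  rw [Finset.card_eq_sum_card_fiberwise (f := fun f => N.filter (f · ∈ R)) (t := N.powerset)
    (fun f _ => Finset.mem_coe.2 (Finset.mem_powerset.2 (Finset.filter_subset _ _)))]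
  refine Finset.sum_congr rfl fun S hS => ?_
  have := card_maps_with_layer (d := d) hRN (Finset.mem_powerset.1 hS) Function.Surjective
  have h2 : ∀ _ : DecidablePred (Function.Surjective : (S → R) → Prop),
      (Finset.univ.filter (Function.Surjective : (S → R) → Prop)).card =
        surjCount (Fintype.card S) (Fintype.card R) := fun _ => by
    rw [← card_surjective, Nat.card_eq_fintype_card, Fintype.card_subtype]
  rw [h2, Fintype.card_coe, Fintype.card_coe] at this
  rw [← this]
  congr 1
  ext f
  simp only [Finset.mem_filter, mem_deepMaps, Finset.mem_univ, true_and, IsDeepMap]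
  constructor
  · rintro ⟨⟨hid, hF, hr, hD⟩, rfl⟩
    refine ⟨hid, rfl, ⟨fun s => ⟨f s, (Finset.mem_filter.1 s.2).2⟩, ?_, fun s => rfl⟩,
      isForestMap_step_iff.1 hF, hD⟩
    rintro ⟨r, hrR⟩
    obtain ⟨v, hv, hvr⟩ := hr r hrR
    exact ⟨⟨v, Finset.mem_filter.2 ⟨hv, hvr ▸ hrR⟩⟩, Subtype.ext hvr⟩
  · rintro ⟨hid, rfl, ⟨g, hg, hfg⟩, hF, hD⟩
    refine ⟨⟨hid, isForestMap_step_iff.2 hF, fun r hr => ?_, hD⟩, rfl⟩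
    obtain ⟨s, hs⟩ := hg ⟨r, hr⟩
    exact ⟨s, (Finset.mem_filter.1 s.2).1, by rw [hfg s, hs]⟩

end Count

/-! ### Cayley's forest formula -/

/-- The factor `N` raises the exponent `N - j - 1` by one, which absorbs the exceptional case `j =
N`. -/
lemma mul_forestCount_sub {N j : ℕ} (hj : j ≤ N) :
    N * forestCount (N - j) j = j * N ^ (N - j) := by
  unfold forestCount
  split_ifs with h
  · obtain rfl : N = j := by omega
    simp
  · rw [Nat.sub_add_cancel hj]
    obtain ⟨m, hm⟩ := Nat.exists_eq_succ_of_ne_zero h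
    rw [hm, Nat.succ_sub_one, pow_succ]
    ring

/-- After multiplication by `N`, the identity `j * C(N, j) = N * C(N - 1, j - 1)` reduces this to
the binomial expansion of `(N + k) ^ (N - 1)`. -/
lemma forestCount_eq_sum {N : ℕ} (hN : N ≠ 0) (k : ℕ) :
    forestCount N k =
      ∑ j ∈ Finset.range (N + 1), N.choose j * (k ^ j * forestCount (N - j) j) := by
  refine Nat.eq_of_mul_eq_mul_left (Nat.pos_of_ne_zero hN) ?_
  rw [Finset.mul_sum]
  have h1 : ∀ j ∈ Finset.range (N + 1), N * (N.choose j * (k ^ j * forestCount (N - j) j)) =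
      N.choose j * j * k ^ j * N ^ (N - j) := fun j hj => by
    have := mul_forestCount_sub (Nat.lt_succ_iff.1 (Finset.mem_range.1 hj))
    calc _ = N.choose j * k ^ j * (N * forestCount (N - j) j) := by ring
      _ = _ := by rw [this]; ring
  rw [Finset.sum_congr rfl h1]
  obtain ⟨M, rfl⟩ := Nat.exists_eq_succ_of_ne_zero hN
  rw [Finset.sum_range_succ']
  simp only [forestCount, hN, if_false, Nat.succ_eq_add_one, Nat.add_sub_cancel, mul_zero,
    zero_mul, add_zero, Nat.add_sub_add_right]
  rw [add_comm (M + 1) k, add_pow, Finset.mul_sum, Finset.mul_sum]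
  refine Finset.sum_congr rfl fun j _ => ?_
  rw [← Nat.add_one_mul_choose_eq, Nat.cast_id]
  ring

section Count

variable {α : Type*} [DecidableEq α] [Fintype α]

lemma card_deepMaps_zero {R N : Finset α} (hRN : Disjoint R N) :
    (deepMaps 0 R N).card = forestCount N.card R.card := by
  induction hn : N.card using Nat.strong_induction_on generalizing R N with
  | _ n ih =>
    rcases N.eq_empty_or_nonempty with rfl | hne
    · rw [Finset.card_empty] at hn
      subst hn
      refine Finset.card_eq_one.2 ⟨id, ?_⟩
      ext f
      simp only [mem_deepMaps, IsDeepMap, Finset.mem_singleton, and_true, Finset.notMem_empty,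
        not_false_eq_true, forall_const]
      exact ⟨fun h => funext h.1, fun h => ⟨fun v => by simp [h], IsForestMap.nil R⟩⟩
    · rw [card_deepMaps_zero_eq_sum hRN, forestCount_eq_sum (by rw [← hn]; exact hne.card_pos.ne'),
        ← hn, Finset.sum_congr rfl, Finset.sum_powerset_apply_card
          (fun j => R.card ^ j * forestCount (N.card - j) j)]
      · simp
      · intro S hS
        have hSN := Finset.mem_powerset.1 hS
        rw [← Finset.card_sdiff_of_subset hSN]
        congr 1
        -- An empty layer leaves `N` undiminished, so induction does not apply; but no forest on a
        -- nonempty set lacks roots, and both counts vanish.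
        rcases S.eq_empty_or_nonempty with rfl | hSne
        · rw [Finset.sdiff_empty, Finset.card_empty, forestCount, if_neg hne.card_pos.ne', zero_mul,
            Finset.card_eq_zero]
          refine Finset.eq_empty_of_forall_notMem fun f hf => hne.ne_empty ?_
          exact (mem_deepMaps.1 hf).2.1.eq_empty_of_roots
        · refine ih _ ?_ Finset.disjoint_sdiff rfl
          have := Finset.card_sdiff_add_card_eq_card hSN
          have := hSne.card_pos
          omega

theorem card_deepMaps {d : ℕ} {R N : Finset α} (hRN : Disjoint R N) :
    (deepMaps d R N).card = deepCount d N.card R.card := by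
  induction d generalizing R N with
  | zero => exact card_deepMaps_zero hRN
  | succ d ih =>
    rw [card_deepMaps_succ_eq_sum hRN, deepCount, Finset.sum_congr rfl,
      Finset.sum_powerset_apply_card (fun j => surjCount j R.card * deepCount d (N.card - j) j)]
    · simp
    · intro S hS
      rw [ih Finset.disjoint_sdiff, Finset.card_sdiff_of_subset (Finset.mem_powerset.1 hS)]

end Count

/-! ### Rooted trees as parent functions -/

/-- The graph whose edges join the nodes to their parents under `f`. -/
def parentGraph {α : Type*} (f : α → α) : SimpleGraph α :=
  SimpleGraph.fromRel fun v w => f v = w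

section Tree

variable {α : Type*} {f : α → α} {r : α} {d : ℕ}

lemma parentGraph_adj {v w : α} : (parentGraph f).Adj v w ↔ v ≠ w ∧ (f v = w ∨ f w = v) :=
  SimpleGraph.fromRel_adj _ _ _

/-- Following parents gives a walk of length `μ v`; no walk is shorter, as `μ` grows by at most one
along an edge. -/
lemma parentGraph_dist (hr : f r = r) {μ : α → ℕ} (h0 : μ r = 0)
    (h1 : ∀ v, v ≠ r → μ v = μ (f v) + 1) (v : α) :
    (parentGraph f).Reachable r v ∧ (parentGraph f).dist r v = μ v := by
  have hup : ∀ n v, μ v = n → ∃ p : (parentGraph f).Walk r v, p.length = n := by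
    intro n
    induction n with
    | zero =>
      intro v hv
      obtain rfl : v = r := by
        by_contra h
        have := h1 v h
        omega
      exact ⟨SimpleGraph.Walk.nil, rfl⟩
    | succ n ih =>
      intro v hv
      have hvr : v ≠ r := by rintro rfl; omega
      have h2 := h1 v hvr
      obtain ⟨p, hp⟩ := ih (f v) (by omega)
      have hadj : (parentGraph f).Adj (f v) v :=
        parentGraph_adj.2 ⟨fun h => by rw [h] at h2; omega, Or.inr rfl⟩
      exact ⟨p.concat hadj, by rw [SimpleGraph.Walk.length_concat, hp]⟩
  have hstep : ∀ {u w}, (parentGraph f).Adj u w → μ w ≤ μ u + 1 := by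
    intro u w h
    obtain ⟨hne, rfl | rfl⟩ := parentGraph_adj.1 h
    · rcases eq_or_ne u r with rfl | hu
      · exact absurd hr.symm hne
      · have := h1 u hu; omega
    · rcases eq_or_ne w r with rfl | hw
      · exact absurd hr hne
      · have := h1 w hw; omega
  have hlow : ∀ {u w} (p : (parentGraph f).Walk u w), μ w ≤ μ u + p.length := by
    intro u w p
    induction p with
    | nil => simp
    | cons h p ih =>
      have := hstep h
      rw [SimpleGraph.Walk.length_cons]
      omega
  obtain ⟨p, hp⟩ := hup _ v rfl
  refine ⟨⟨p⟩, le_antisymm (hp ▸ SimpleGraph.dist_le p) ?_⟩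
  obtain ⟨q, hq⟩ := (SimpleGraph.Walk.reachable p).exists_walk_length_eq_dist
  have := hlow q
  omega

lemma le_rootDist_iff {G : SimpleGraph α} (hG : G.Connected) :
    (d : ℕ∞) ≤ rootDist G r ↔ ∀ v, G.dist r v < d → ∃ w, IsChild G r v w := by
  have he : ∀ v, (d : ℕ∞) ≤ G.edist r v ↔ d ≤ G.dist r v := fun v => by
    rw [← (hG r v).coe_dist_eq_edist, Nat.cast_le]
  simp only [rootDist, le_iInf_iff, he, leaves, Set.mem_ofPred_eq]
  refine forall_congr' fun v => ?_
  rw [← not_imp_not, not_le]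
  push Not
  rfl

variable [DecidableEq α] [Fintype α]

lemma exists_rank_of_mem_deepMaps (hf : f ∈ deepMaps d {r} {r}ᶜ) :
    f r = r ∧ ∃ μ : α → ℕ, μ r = 0 ∧ ∀ v, v ≠ r → μ v = μ (f v) + 1 := by
  obtain ⟨hid, hF, -⟩ := mem_deepMaps.1 hf
  obtain ⟨μ, h0, h1⟩ := hF.exists_rank disjoint_compl_right
  exact ⟨hid r (by simp), μ, h0 r (by simp), fun v hv => h1 v (by simpa using hv)⟩

lemma parentGraph_connected (hf : f ∈ deepMaps d {r} {r}ᶜ) : (parentGraph f).Connected := by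
  obtain ⟨hr, μ, h0, h1⟩ := exists_rank_of_mem_deepMaps hf
  exact SimpleGraph.connected_iff_exists_forall_reachable _ |>.2
    ⟨r, fun v => (parentGraph_dist hr h0 h1 v).1⟩

lemma parentGraph_dist_eq (hf : f ∈ deepMaps d {r} {r}ᶜ) {v : α} (hv : v ≠ r) :
    (parentGraph f).dist r v = (parentGraph f).dist r (f v) + 1 := by
  obtain ⟨hr, μ, h0, h1⟩ := exists_rank_of_mem_deepMaps hf
  rw [(parentGraph_dist hr h0 h1 v).2, (parentGraph_dist hr h0 h1 (f v)).2, h1 v hv]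

lemma isChild_parentGraph_iff (hf : f ∈ deepMaps d {r} {r}ᶜ) {v w : α} :
    IsChild (parentGraph f) r v w ↔ w ≠ r ∧ f w = v := by
  have hr := (exists_rank_of_mem_deepMaps hf).1
  rw [IsChild, parentGraph_adj]
  constructor
  · rintro ⟨⟨hne, h⟩, hd⟩
    have hw : w ≠ r := by
      rintro rfl
      simp at hd
    refine ⟨hw, h.resolve_left ?_⟩
    rintro rfl
    rcases eq_or_ne v r with rfl | hv
    · exact hne hr.symm
    · have := parentGraph_dist_eq hf hv
      omega
  · rintro ⟨hw, rfl⟩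
    have := parentGraph_dist_eq hf hw
    exact ⟨⟨fun h => by rw [h] at this; omega, Or.inr rfl⟩, this⟩

lemma isTree_parentGraph (hf : f ∈ deepMaps d {r} {r}ᶜ) : (parentGraph f).IsTree := by
  have hc := parentGraph_connected hf
  have hr := (exists_rank_of_mem_deepMaps hf).1
  -- Every edge joins a non-root to its parent, so there are at most `n - 1` edges.
  refine SimpleGraph.isTree_iff_connected_and_card.2 ⟨hc, le_antisymm ?_
    hc.card_vert_le_card_edgeSet_add_one⟩
  have hsub : (parentGraph f).edgeSet ⊆
      (({r}ᶜ : Finset α).image fun v => s(v, f v) : Finset (Sym2 α)) := by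
    intro e he
    induction e with
    | _ v w =>
      rw [SimpleGraph.mem_edgeSet, parentGraph_adj] at he
      simp only [Finset.coe_image, Set.mem_image, Finset.mem_coe, Finset.mem_compl,
        Finset.mem_singleton]
      obtain ⟨hne, rfl | rfl⟩ := he
      · exact ⟨v, fun h => hne (by rw [h, hr]), rfl⟩
      · exact ⟨w, fun h => hne (by rw [h, hr]), Sym2.eq_swap⟩
  have h1 : Nat.card (parentGraph f).edgeSet ≤ _ := Set.ncard_le_ncard hsub
  rw [Set.ncard_coe_finset] at h1
  have h2 := h1.trans Finset.card_image_le
  rw [Finset.card_compl, Finset.card_singleton] at h2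
  have : 0 < Fintype.card α := Fintype.card_pos_iff.2 ⟨r⟩
  rw [Nat.card_eq_fintype_card (α := α)]
  omega

lemma eq_of_parentGraph_eq {g : α → α} {d' : ℕ} (hf : f ∈ deepMaps d {r} {r}ᶜ)
    (hg : g ∈ deepMaps d' {r} {r}ᶜ) (h : parentGraph f = parentGraph g) : f = g := by
  funext v
  rcases eq_or_ne v r with rfl | hv
  · rw [(exists_rank_of_mem_deepMaps hf).1, (exists_rank_of_mem_deepMaps hg).1]
  · have h1 := (isChild_parentGraph_iff hf).2 ⟨hv, rfl⟩
    rw [h] at h1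
    exact ((isChild_parentGraph_iff hg).1 h1).2.symm

lemma exists_parentGraph_eq {G : SimpleGraph α} (hG : G.IsTree) (r : α) :
    ∃ f ∈ deepMaps 0 {r} {r}ᶜ, parentGraph f = G := by
  have hpar : ∀ v, v ≠ r → ∃ w, G.Adj v w ∧ G.dist r v = G.dist r w + 1 := by
    intro v hv
    obtain ⟨p, hp⟩ := hG.connected.exists_walk_length_eq_dist v r
    cases p with
    | nil => exact absurd rfl hv
    | @cons _ w _ h p =>
      refine ⟨w, h, ?_⟩
      rw [SimpleGraph.Walk.length_cons] at hp
      have h1 := SimpleGraph.dist_le p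
      have h2 := hG.connected.dist_triangle (u := r) (v := w) (w := v)
      rw [SimpleGraph.dist_comm (u := w) (v := v), SimpleGraph.dist_eq_one_iff_adj.2 h] at h2
      rw [SimpleGraph.dist_comm] at hp h1
      omega
  choose! p hadj hdist using hpar
  have hmem : (fun v => if v = r then r else p v) ∈ deepMaps 0 {r} {r}ᶜ := by
    refine mem_deepMaps.2 ⟨fun v hv => ?_, isForestMap_of_rank (G.dist r) (fun v _ => ?_)
      (fun v hv => ?_), trivial⟩
    · obtain rfl : v = r := by simpa using hv
      simp
    · simp only [Finset.mem_singleton, Finset.mem_compl]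
      exact em _
    · have hv : v ≠ r := by simpa using hv
      simp only [hv, if_false]
      have := hdist v hv
      omega
  refine ⟨_, hmem, ?_⟩
  have hle : parentGraph (fun v => if v = r then r else p v) ≤ G := by
    intro v w h
    obtain ⟨hne, h | h⟩ := parentGraph_adj.1 h
    · split_ifs at h with hv
      · exact absurd (hv.trans h) hne
      · exact h ▸ hadj v hv
    · split_ifs at h with hw
      · exact absurd (hw.trans h).symm hne
      · exact (h ▸ hadj w hw).symm
  -- A tree has no proper connected spanning subgraph.
  exact (SimpleGraph.isTree_iff_minimal_connected.1 hG).eq_of_le (parentGraph_connected hmem) hle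

lemma mem_deepMaps_iff_le_rootDist :
    f ∈ deepMaps d {r} {r}ᶜ ↔
      f ∈ deepMaps 0 {r} {r}ᶜ ∧ (d : ℕ∞) ≤ rootDist (parentGraph f) r := by
  have h : f ∈ deepMaps d {r} {r}ᶜ ↔
      f ∈ deepMaps 0 {r} {r}ᶜ ∧ IsDeepMap f d {r} {r}ᶜ := by
    simp [mem_deepMaps, IsDeepMap, and_assoc]
  rw [h]
  refine and_congr_right fun hf => ?_
  obtain ⟨hr, μ, h0, h1⟩ := exists_rank_of_mem_deepMaps hf
  rw [le_rootDist_iff (parentGraph_connected hf), isDeepMap_iff_of_rank (μ := μ) (c := 0)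
    disjoint_compl_right (mem_deepMaps.1 hf).2.1.mem_or_mem (by simpa using h0)
    (fun v hv => by rw [h1 v (by simpa using hv)]; omega) (fun v hv => h1 v (by simpa using hv))]
  simp [isChild_parentGraph_iff hf, (parentGraph_dist hr h0 h1 _).2]

theorem ncard_trees_le_rootDist (d : ℕ) :
    {p : SimpleGraph α × α | p.1.IsTree ∧ (d : ℕ∞) ≤ rootDist p.1 p.2}.ncard =
      Fintype.card α * deepCount d (Fintype.card α - 1) 1 := by
  have hset : {p : SimpleGraph α × α | p.1.IsTree ∧ (d : ℕ∞) ≤ rootDist p.1 p.2} =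
      (fun x : (_ : α) × (α → α) => (parentGraph x.2, x.1)) ''
        (Finset.univ.sigma fun r => deepMaps d {r} {r}ᶜ : Finset ((_ : α) × (α → α))) := by
    ext ⟨G, r⟩
    simp only [Set.mem_ofPred_eq, Set.mem_image, Finset.mem_coe, Finset.mem_sigma, Finset.mem_univ,
      true_and, Prod.mk.injEq, Sigma.exists]
    constructor
    · rintro ⟨hG, hd⟩
      obtain ⟨f, hf, rfl⟩ := exists_parentGraph_eq hG r
      exact ⟨r, f, mem_deepMaps_iff_le_rootDist.2 ⟨hf, hd⟩, rfl, rfl⟩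
    · rintro ⟨_, f, hf, rfl, rfl⟩
      exact ⟨isTree_parentGraph hf, (mem_deepMaps_iff_le_rootDist.1 hf).2⟩
  rw [hset, Set.InjOn.ncard_image, Set.ncard_coe_finset, Finset.card_sigma]
  · have hcard : ∀ r : α, (deepMaps d {r} {r}ᶜ).card = deepCount d (Fintype.card α - 1) 1 :=
      fun r => by
        rw [card_deepMaps disjoint_compl_right, Finset.card_compl, Finset.card_singleton]
    simp [hcard]
  · rintro ⟨r, f⟩ hf ⟨r', g⟩ hg h
    simp only [Finset.mem_coe, Finset.mem_sigma, Finset.mem_univ, true_and] at hf hg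
    obtain ⟨h1, rfl⟩ := Prod.mk.inj h
    rw [eq_of_parentGraph_eq hf hg h1]

end Tree

lemma deepRootProb_eq {n : ℕ} (hn : n ≠ 0) :
    deepRootProb n = deepCount 3 (n - 1) 1 / forestCount (n - 1) 1 := by
  have h1 : (deepRootedTrees n).ncard = n * deepCount 3 (n - 1) 1 := by
    have := ncard_trees_le_rootDist (α := Fin n) 3
    rwa [Fintype.card_fin] at this
  have h2 : (rootedTrees n).ncard = n * forestCount (n - 1) 1 := by
    have := ncard_trees_le_rootDist (α := Fin n) 0
    simp only [Nat.cast_zero, zero_le, and_true, Fintype.card_fin, deepCount] at this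
    exact this
  rw [deepRootProb, h1, h2]
  push_cast
  exact mul_div_mul_left _ _ (Nat.cast_ne_zero.2 hn)

/-! ### Generating function of surjections -/

section Surjections

-- Sorts all maps by their image.
open Classical in
lemma sum_choose_mul_surjCount (j k : ℕ) :
    ∑ i ∈ Finset.range (k + 1), k.choose i * surjCount j i = k ^ j := by
  have h1 : (Finset.univ : Finset (Fin j → Fin k)).card = k ^ j := by simp
  rw [← h1, Finset.card_eq_sum_card_fiberwise (f := fun g => Finset.univ.image g)
    (t := (Finset.univ : Finset (Fin k)).powerset)
    (fun f _ => Finset.mem_coe.2 (Finset.mem_powerset.2 (Finset.subset_univ _)))]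
  have h2 : ∀ T ∈ (Finset.univ : Finset (Fin k)).powerset,
      (Finset.univ.filter fun g : Fin j → Fin k => Finset.univ.image g = T).card =
        surjCount j T.card := by
    intro T _
    have h := card_surjective (Fin j) T
    rw [Fintype.card_fin, Fintype.card_coe] at h
    rw [← h, ← Fintype.card_subtype, ← Nat.card_eq_fintype_card]
    refine Nat.card_congr
      { toFun := fun g => ⟨fun a => ⟨g.1 a, ?_⟩, ?_⟩
        invFun := fun g => ⟨fun a => (g.1 a : Fin k), ?_⟩
        left_inv := fun g => rfl
        right_inv := fun g => rfl }
    · have := Finset.mem_image_of_mem g.1 (Finset.mem_univ a)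
      rwa [g.2] at this
    · rintro ⟨t, ht⟩
      have ht' := ht
      rw [← g.2, Finset.mem_image] at ht'
      obtain ⟨a, -, ha⟩ := ht'
      exact ⟨a, Subtype.ext ha⟩
    · ext t
      simp only [Finset.mem_image, Finset.mem_univ, true_and]
      constructor
      · rintro ⟨a, rfl⟩
        exact (g.1 a).2
      · intro ht
        obtain ⟨a, ha⟩ := g.2 ⟨t, ht⟩
        exact ⟨a, by rw [ha]⟩
  rw [Finset.sum_congr rfl h2, Finset.sum_powerset_apply_card]
  simp

lemma surjCount_le (j k : ℕ) : surjCount j k ≤ k ^ j := by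
  rw [← sum_choose_mul_surjCount j k, Finset.sum_range_succ, Nat.choose_self, one_mul]
  exact Nat.le_add_left _ _

lemma hasSum_mul_pow_div_factorial (k : ℕ) (x : ℝ) :
    HasSum (fun j : ℕ => (k : ℝ) ^ j * (j * x ^ (j - 1) / j.factorial))
      (k * Real.exp (k * x)) := by
  rw [← hasSum_nat_add_iff' 1]
  have h := (NormedSpace.expSeries_div_hasSum_exp (k * x : ℝ)).mul_left (k : ℝ)
  rw [← Real.exp_eq_exp_ℝ] at h
  simp only [Finset.range_one, Finset.sum_singleton, Nat.cast_zero, zero_mul, zero_div, mul_zero,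
    sub_zero]
  refine h.congr_fun fun j => ?_
  have : (j.factorial : ℝ) ≠ 0 := Nat.cast_ne_zero.2 j.factorial_ne_zero
  rw [Nat.add_sub_cancel, Nat.factorial_succ, Nat.cast_mul, pow_succ, mul_pow]
  have : ((j + 1 : ℕ) : ℝ) ≠ 0 := Nat.cast_ne_zero.2 j.succ_ne_zero
  field_simp

lemma sum_choose_mul_mul_pow (k : ℕ) (y : ℝ) :
    ∑ i ∈ Finset.range (k + 1), (k.choose i : ℝ) * (i * y ^ (i - 1)) = k * (y + 1) ^ (k - 1) := by
  rcases k with _ | k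
  · simp
  · rw [Finset.sum_range_succ', Nat.add_sub_cancel, add_pow, Finset.mul_sum]
    simp only [Nat.cast_zero, zero_mul, mul_zero, add_zero, one_pow, mul_one, Nat.add_sub_cancel]
    refine Finset.sum_congr rfl fun i _ => ?_
    have : ((k + 1 : ℕ) : ℝ) * k.choose i = (k + 1).choose (i + 1) * (i + 1 : ℕ) := by
      exact_mod_cast Nat.add_one_mul_choose_eq k i
    linear_combination -y ^ i * this

/-- This is the derivative of `(e ^ x - 1) ^ k`. No differentiation of series is needed: solving
`sum_choose_mul_surjCount` for its top term reduces it, by strong induction on `k`, to exponential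
series. -/
lemma hasSum_surjCount (k : ℕ) (x : ℝ) :
    HasSum (fun j : ℕ => (surjCount j k : ℝ) * (j * x ^ (j - 1) / j.factorial))
      (k * Real.exp x * (Real.exp x - 1) ^ (k - 1)) := by
  induction k using Nat.strong_induction_on with
  | _ k ih =>
    have h1 := hasSum_sum (s := Finset.range k) fun i hi =>
      (ih i (Finset.mem_range.1 hi)).mul_left (k.choose i : ℝ)
    have h2 := (hasSum_mul_pow_div_factorial k x).sub h1
    have hval : (k : ℝ) * Real.exp x * (Real.exp x - 1) ^ (k - 1) = k * Real.exp (k * x) -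
        ∑ i ∈ Finset.range k,
          (k.choose i : ℝ) * (i * Real.exp x * (Real.exp x - 1) ^ (i - 1)) := by
      have h := sum_choose_mul_mul_pow k (Real.exp x - 1)
      rw [Finset.sum_range_succ, Nat.choose_self, sub_add_cancel] at h
      have h3 : (k : ℝ) * Real.exp (k * x) = k * Real.exp x ^ (k - 1) * Real.exp x := by
        rcases k with _ | k
        · simp
        · rw [Real.exp_nat_mul, Nat.add_sub_cancel, pow_succ, mul_assoc]
      rw [h3, ← h, add_mul, Finset.sum_mul]
      have h4 : ∀ i, (k.choose i : ℝ) * (i * (Real.exp x - 1) ^ (i - 1)) * Real.exp x =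
          k.choose i * (i * Real.exp x * (Real.exp x - 1) ^ (i - 1)) := fun i => by ring
      simp only [h4]
      push_cast
      ring
    rw [hval]
    refine h2.congr_fun fun j => ?_
    have h := sum_choose_mul_surjCount j k
    rw [Finset.sum_range_succ, Nat.choose_self, one_mul] at h
    rw [← Nat.cast_pow, ← h]
    push_cast
    rw [add_mul, Finset.sum_mul]
    simp only [mul_assoc]
    ring

end Surjections

/-! ### Limits of the normalized counts -/

section Asymptotics

open Filter Topology

lemma deepCount_le (d N k : ℕ) : deepCount d N k ≤ forestCount N k := by
  induction d generalizing N k with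
  | zero => exact le_rfl
  | succ d ih =>
    have hle : deepCount (d + 1) N k ≤
        ∑ j ∈ Finset.range (N + 1), N.choose j * (k ^ j * forestCount (N - j) j) :=
      Finset.sum_le_sum fun j _ => Nat.mul_le_mul_left _ (Nat.mul_le_mul (surjCount_le j k) (ih _ _))
    rcases eq_or_ne N 0 with rfl | hN
    · simpa [forestCount] using hle
    · rwa [← forestCount_eq_sum hN] at hle

/-- The pair `(α, β)` such that `k * β * α ^ (k - 1)` is the limit of
`deepCount d N k / N ^ (N - 1)`. -/
noncomputable def deepParams : ℕ → ℝ × ℝ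
  | 0 => (Real.exp 1, Real.exp 1)
  | d + 1 => (Real.exp ((deepParams d).1 / Real.exp 1) - 1,
      (deepParams d).2 / Real.exp 1 * Real.exp ((deepParams d).1 / Real.exp 1))

/-- The limit of `deepCount d N k / N ^ (N - 1)` as `N → ∞`. -/
noncomputable def deepLimit (d k : ℕ) : ℝ :=
  k * (deepParams d).2 * (deepParams d).1 ^ (k - 1)

lemma tendsto_one_add_div_pow_pred (k : ℕ) :
    Tendsto (fun N : ℕ => (1 + (k : ℝ) / N) ^ (N - 1)) atTop (𝓝 (Real.exp k)) := by
  have h1 := Real.tendsto_one_add_div_pow_exp k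
  have h2 : Tendsto (fun N : ℕ => 1 + (k : ℝ) / N) atTop (𝓝 (1 + 0)) :=
    tendsto_const_nhds.add (tendsto_const_div_atTop_nhds_zero_nat _)
  have h3 := h1.div h2 (by norm_num)
  rw [add_zero, div_one] at h3
  refine h3.congr' ?_
  filter_upwards [eventually_ge_atTop 1] with N hN
  have : (1 + (k : ℝ) / N) ≠ 0 := by positivity
  rw [Pi.div_apply, div_eq_iff this, ← pow_succ, Nat.sub_add_cancel hN]

lemma tendsto_forestCount (k : ℕ) :
    Tendsto (fun N : ℕ => (forestCount N k : ℝ) / N ^ (N - 1)) atTop (𝓝 (k * Real.exp k)) := by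
  refine ((tendsto_one_add_div_pow_pred k).const_mul (k : ℝ)).congr' ?_
  filter_upwards [eventually_ne_atTop 0] with N hN
  have hN' : (N : ℝ) ≠ 0 := Nat.cast_ne_zero.2 hN
  rw [forestCount, if_neg hN, one_add_div hN', div_pow]
  push_cast
  ring

lemma tendsto_choose_div_pow (j : ℕ) :
    Tendsto (fun N : ℕ => (N.choose j : ℝ) / N ^ j) atTop (𝓝 (1 / j.factorial)) := by
  have hz : ∀ᶠ N : ℕ in atTop, (N : ℝ) ^ j / j.factorial ≠ 0 := by
    filter_upwards [eventually_ne_atTop 0] with N hN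
    have : (j.factorial : ℝ) ≠ 0 := Nat.cast_ne_zero.2 j.factorial_ne_zero
    have hN' : (N : ℝ) ≠ 0 := Nat.cast_ne_zero.2 hN
    positivity
  have h := (Asymptotics.isEquivalent_iff_tendsto_one hz).1 (isEquivalent_choose j)
  have h2 := h.mul_const (1 / (j.factorial : ℝ))
  rw [one_mul] at h2
  refine h2.congr fun N => ?_
  have : (j.factorial : ℝ) ≠ 0 := Nat.cast_ne_zero.2 j.factorial_ne_zero
  simp only [Pi.div_apply]
  field_simp

lemma tendsto_deepCount_summand {d : ℕ} (k j : ℕ)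
    (h : Tendsto (fun N : ℕ => (deepCount d N j : ℝ) / N ^ (N - 1)) atTop (𝓝 (deepLimit d j))) :
    Tendsto (fun N : ℕ => ((N.choose j * (surjCount j k * deepCount d (N - j) j) : ℕ) : ℝ) /
      N ^ (N - 1)) atTop
      (𝓝 (1 / j.factorial * surjCount j k * deepLimit d j * (Real.exp j)⁻¹)) := by
  -- With `N = M + j`, the ratio `M ^ (M - 1) / (M + j) ^ (M - 1)` supplies the factor `e ^ (-j)`.
  rw [← tendsto_add_atTop_iff_nat j]
  have h1 := (tendsto_choose_div_pow j).comp (tendsto_add_atTop_nat j)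
  have h2 := (tendsto_one_add_div_pow_pred j).inv₀ (Real.exp_ne_zero _)
  refine (((h1.mul_const (surjCount j k : ℝ)).mul h).mul h2).congr' ?_
  filter_upwards [eventually_ge_atTop 1] with M hM
  have hM' : (M : ℝ) ≠ 0 := Nat.cast_ne_zero.2 (by omega)
  have hMj : ((M : ℝ) + j) ≠ 0 := by positivity
  have e : M + j - 1 = j + (M - 1) := by omega
  simp only [Function.comp_apply, Nat.add_sub_cancel]
  rw [e, pow_add, one_add_div hM', div_pow]
  push_cast
  field_simp

/-- The dominating bound, independent of `N`: surjections are at most all maps, and deep forests at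
most all forests. The factor `1 ^ (j - 1)` matches `hasSum_mul_pow_div_factorial` at `x = 1`. -/
lemma deepCount_summand_le {d N k j : ℕ} (hN : N ≠ 0) :
    ((N.choose j * (surjCount j k * deepCount d (N - j) j) : ℕ) : ℝ) / N ^ (N - 1) ≤
      (k : ℝ) ^ j * (j * 1 ^ (j - 1) / j.factorial) := by
  have hfac : (0 : ℝ) < j.factorial := Nat.cast_pos.2 j.factorial_pos
  have hN' : (0 : ℝ) < N := Nat.cast_pos.2 (Nat.pos_of_ne_zero hN)
  rcases lt_or_ge N j with hj | hj
  · rw [Nat.choose_eq_zero_of_lt hj]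
    simp only [zero_mul, Nat.cast_zero, zero_div]
    positivity
  · have h1 : (deepCount d (N - j) j : ℝ) ≤ j * N ^ (N - j) / N := by
      rw [le_div_iff₀ hN']
      have := Nat.mul_le_mul_left N (deepCount_le d (N - j) j)
      rw [mul_forestCount_sub hj] at this
      rw [mul_comm]
      exact_mod_cast this
    have h2 : (surjCount j k : ℝ) ≤ (k : ℝ) ^ j := by exact_mod_cast surjCount_le j k
    have h3 : (N.choose j : ℝ) ≤ (N : ℝ) ^ j / j.factorial := Nat.choose_le_pow_div j N
    rw [div_le_iff₀ (by positivity)]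
    push_cast
    calc (N.choose j : ℝ) * (surjCount j k * deepCount d (N - j) j)
        ≤ (N : ℝ) ^ j / j.factorial * ((k : ℝ) ^ j * (j * N ^ (N - j) / N)) := by gcongr
      _ = (k : ℝ) ^ j * (j / j.factorial) * (N ^ j * N ^ (N - j) / N) := by ring
      _ = _ := by
        rw [← pow_add, Nat.add_sub_cancel' hj]
        obtain ⟨M, rfl⟩ := Nat.exists_eq_succ_of_ne_zero hN
        rw [pow_succ, Nat.succ_sub_one, mul_div_cancel_right₀ _ hN'.ne', one_pow, mul_one]

theorem tendsto_deepCount (d k : ℕ) :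
    Tendsto (fun N : ℕ => (deepCount d N k : ℝ) / N ^ (N - 1)) atTop (𝓝 (deepLimit d k)) := by
  induction d generalizing k with
  | zero =>
    have h0 : deepLimit 0 k = k * Real.exp k := by
      rcases k with _ | k
      · simp [deepLimit]
      · rw [deepLimit, deepParams, Nat.add_sub_cancel, mul_assoc, ← pow_succ', ← Real.exp_nat_mul,
          mul_one]
    rw [h0]
    exact tendsto_forestCount k
  | succ d ih =>
    have hlim := tendsto_tsum_of_dominated_convergence
      (hasSum_mul_pow_div_factorial k 1).summable
      (fun j => tendsto_deepCount_summand k j (ih j)) (by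
        filter_upwards [eventually_ne_atTop 0] with N hN j
        rw [Real.norm_of_nonneg (by positivity)]
        exact deepCount_summand_le hN)
    have hval : ∑' j : ℕ, 1 / (j.factorial : ℝ) * surjCount j k * deepLimit d j * (Real.exp j)⁻¹ =
        deepLimit (d + 1) k := by
      -- The limiting summand carries `β α ^ (j - 1) e ^ (-j) = (β / e) (α / e) ^ (j - 1)`.
      have h := (hasSum_surjCount k ((deepParams d).1 / Real.exp 1)).mul_left
        ((deepParams d).2 / Real.exp 1)
      refine HasSum.tsum_eq ?_
      have hv : deepLimit (d + 1) k = (deepParams d).2 / Real.exp 1 *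
          (k * Real.exp ((deepParams d).1 / Real.exp 1) *
            (Real.exp ((deepParams d).1 / Real.exp 1) - 1) ^ (k - 1)) := by
        rw [deepLimit, deepParams]
        ring
      rw [hv]
      refine h.congr_fun fun j => ?_
      rcases j with _ | j
      · simp [deepLimit]
      · rw [deepLimit, Nat.add_sub_cancel, div_pow, ← Real.exp_nat_mul, mul_one, Nat.cast_succ,
          Real.exp_add]
        field_simp
    rw [hval] at hlim
    refine hlim.congr fun N => ?_
    rw [tsum_eq_sum (s := Finset.range (N + 1)), deepCount, Nat.cast_sum, Finset.sum_div]
    intro j hj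
    rw [Nat.choose_eq_zero_of_lt (by simpa using hj)]
    simp

end Asymptotics

/-! ### The constant and the conclusion -/

lemma deepLimit_three_one : deepLimit 3 1 = c₃ * Real.exp 1 := by
  have h : Real.exp (1 - 1 / Real.exp 1) = Real.exp ((Real.exp 1 - 1) / Real.exp 1) := by
    congr 1
    field_simp
  have h2 : Real.exp ((Real.exp 1 - 1) / Real.exp 1) =
      Real.exp 1 * Real.exp (-(1 / Real.exp 1)) := by
    rw [← h, sub_eq_add_neg, Real.exp_add]
  simp only [deepLimit, deepParams, c₃, h, div_self (Real.exp_ne_zero 1)]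
  rw [h2]
  field_simp
  simp

lemma abs_c₃_sub_lt : |c₃ - 0.3522| < 0.00005 := by
  set t := Real.exp (-1) with ht
  have hinv : 1 / Real.exp 1 = t := by rw [ht, Real.exp_neg, one_div]
  have ht1 : (0.367879 : ℝ) < t := by
    rw [← hinv, lt_div_iff₀ (Real.exp_pos 1)]
    linarith [Real.exp_one_lt_d9]
  have ht2 : t < 0.36788 := by
    rw [← hinv, div_lt_iff₀ (Real.exp_pos 1)]
    linarith [Real.exp_one_gt_d9]
  set y := Real.exp (-t) with hy
  have hy1 : 0.69219 < y := by
    have h1 : Real.exp (-0.36788) < y := Real.exp_lt_exp.2 (by linarith)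
    have h2 := Real.exp_bound (x := -0.36788) (by norm_num [abs_le]) (n := 8) (by norm_num)
    rw [abs_le] at h2
    norm_num [Finset.sum_range_succ, Nat.factorial] at h2 h1
    linarith [h2.1]
  have hy2 : y < 0.69221 := by
    have h1 : y < Real.exp (-0.367879) := Real.exp_lt_exp.2 (by linarith)
    have h2 := Real.exp_bound (x := -0.367879) (by norm_num [abs_le]) (n := 8) (by norm_num)
    rw [abs_le] at h2
    norm_num [Finset.sum_range_succ, Nat.factorial] at h2 h1
    linarith [h2.2]
  -- Since `e ^ (1 - 1/e) / e = y`, only `t` and two exponentials of small numbers need bounding;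
  -- the Taylor points below come from the interval ends for `t` and `y`.
  have hc : c₃ = t * Real.exp (y - 2 * t) := by
    have h : (Real.exp (1 - 1 / Real.exp 1) - 1) / Real.exp 1 = y - t := by
      rw [sub_eq_add_neg 1, Real.exp_add, hinv, sub_div, mul_div_cancel_left₀ _ (Real.exp_ne_zero 1),
        hinv]
    rw [c₃, h, hinv, mul_assoc, ← Real.exp_add]
    congr 2
    ring
  set z := Real.exp (y - 2 * t) with hz
  have hz1 : 0.95735 < z := by
    have h1 : Real.exp (-0.04357) < z := Real.exp_lt_exp.2 (by linarith)
    have h2 := Real.exp_bound (x := -0.04357) (by norm_num [abs_le]) (n := 5) (by norm_num)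
    rw [abs_le] at h2
    norm_num [Finset.sum_range_succ, Nat.factorial] at h2 h1
    linarith [h2.1]
  have hz2 : z < 0.9574 := by
    have h1 : z < Real.exp (-0.043548) := Real.exp_lt_exp.2 (by linarith)
    have h2 := Real.exp_bound (x := -0.043548) (by norm_num [abs_le]) (n := 5) (by norm_num)
    rw [abs_le] at h2
    norm_num [Finset.sum_range_succ, Nat.factorial] at h2 h1
    linarith [h2.2]
  rw [hc, abs_lt]
  constructor <;> nlinarith

theorem mainTheorem3 :
    Filter.Tendsto deepRootProb Filter.atTop (nhds c₃) ∧ |c₃ - 0.3522| < 0.00005 := by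
  refine ⟨?_, abs_c₃_sub_lt⟩
  have h := (tendsto_deepCount 3 1).div (tendsto_forestCount 1) (by simp [Real.exp_ne_zero])
  rw [deepLimit_three_one, Nat.cast_one, one_mul, mul_div_cancel_right₀ _ (Real.exp_ne_zero 1)] at h
  -- A tree on `N + 1` nodes has one root and `N` other nodes.
  rw [← Filter.tendsto_add_atTop_iff_nat 1]
  refine h.congr' ?_
  filter_upwards [Filter.eventually_ne_atTop 0] with N hN
  have hN' : (N : ℝ) ^ (N - 1) ≠ 0 := pow_ne_zero _ (Nat.cast_ne_zero.2 hN)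
  rw [deepRootProb_eq N.succ_ne_zero, Nat.succ_sub_one, Pi.div_apply,
    div_div_div_cancel_right₀ hN']
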